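/- Let $D$ be an integrally closed domain with quotient field $K$, let $\overline K$ be an algebraic closure of $K$, let $n$ be a positive integer and $f\in K[X]$. For $k\ge 0$ the $k$-th divided difference $\Phi^k(f)\in K[X_0,\dots,X_k]$ of $f$ is defined recursively by $\Phi^0(f)(X_0)=f(X_0)$ and $$\Phi^{k}(f)(X_0,\dots,X_k)=\frac{\Phi^{k-1}(f)(X_0,\dots,X_{k-1})-\Phi^{k-1}(f)(X_0,\dots,X_{k-2},X_k)}{X_{k-1}-X_k}\qquad(k\ge 1);$$ it is a symmetric polynomial. The multiset of roots of a polynomial in $\overline K$ contains each root as often as its multiplicity. Let $\mathrm{Int}(M_n(D))$ be the set of those $f\in K[X]$ such that $f(M)\in M_n(D)$ for every $M\in M_n(D)$. Then $f\in\mathrm{Int}(M_n(D))$ if and only if, for every $0\le k<n$, every monic polynomial $p\in D[X]$ of degree $n$ and every sub-multiset $\{\alpha_1,\dots,\alpha_{k+1}\}$ with $k+1$ elements of the multiset of roots of $p$ in $\overline K$, the element $\Phi^k(f)(\alpha_1,\dots,\alpha_{k+1})$ is integral over $D$. If moreover the intersection of the maximal ideals of $D$ of finite index (that is, with finite residue field;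 an empty intersection being $D$) is $(0)$, then it is sufficient to consider irreducible $p$: $f\in\mathrm{Int}(M_n(D))$ if and only if the condition above holds for every $0\le k<n$ and every monic $p\in D[X]$ of degree $n$ that is irreducible in $D[X]$. -/

import Mathlib

open Polynomial

noncomputable section

/-- A polynomial `Q(X_0, …, X_k)` minus `Q(X_0, …, X_{k-1}, X_{k+1})` is divisible by
`X_k - X_{k+1}` in the ring of polynomials in `X_0, …, X_{k+1}`. -/
theorem X_sub_X_dvd_rename_sub_rename {R : Type*} [CommRing R] {k : ℕ}
    (Q : MvPolynomial (Fin (k + 1)) R) :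
    (MvPolynomial.X (Fin.last k).castSucc - MvPolynomial.X (Fin.last (k + 1)) :
        MvPolynomial (Fin (k + 2)) R) ∣
      MvPolynomial.rename Fin.castSucc Q -
        MvPolynomial.rename (Fin.last k).castSucc.succAbove Q := by
  rw [← Ideal.mem_span_singleton, ← Ideal.Quotient.eq]
  set I : Ideal (MvPolynomial (Fin (k + 2)) R) := Ideal.span
    {MvPolynomial.X (Fin.last k).castSucc - MvPolynomial.X (Fin.last (k + 1))} with hI
  have h : ((Ideal.Quotient.mkₐ R I).comp (MvPolynomial.rename Fin.castSucc)) =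
      ((Ideal.Quotient.mkₐ R I).comp
        (MvPolynomial.rename (Fin.last k).castSucc.succAbove)) := by
    refine MvPolynomial.algHom_ext fun i => ?_
    induction i using Fin.lastCases with
    | last =>
      simp only [AlgHom.comp_apply, MvPolynomial.rename_X, Ideal.Quotient.mkₐ_eq_mk,
        Fin.succAbove_castSucc_self, Fin.succ_last]
      rw [Ideal.Quotient.eq]
      exact Ideal.subset_span rfl
    | cast i =>
      have : (Fin.last k).castSucc.succAbove i.castSucc = i.castSucc.castSucc :=
        Fin.succAbove_of_castSucc_lt _ _ (by simp [Fin.lt_def])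
      simp [this]
  exact DFunLike.congr_fun h Q

/-- The `k`-th divided difference `Φ^k(f)(X_0, …, X_k)` of a polynomial `f` over a domain, as a
polynomial in `k + 1` variables: `Φ^0(f) = f(X_0)`, and `Φ^{k+1}(f)(X_0, …, X_{k+1})` is the exact
quotient of `Φ^k(f)(X_0, …, X_k) - Φ^k(f)(X_0, …, X_{k-1}, X_{k+1})` by `X_k - X_{k+1}`
(see `X_sub_X_mul_dividedDifference_succ` and `eq_dividedDifference_succ`). -/
def dividedDifference {R : Type*} [CommRing R] [IsDomain R] (f : R[X]) :
    (k : ℕ) → MvPolynomial (Fin (k + 1)) R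
  | 0 => Polynomial.aeval (MvPolynomial.X 0) f
  | k + 1 => (X_sub_X_dvd_rename_sub_rename (dividedDifference f k)).choose

theorem dividedDifference_zero {R : Type*} [CommRing R] [IsDomain R] (f : R[X]) :
    dividedDifference f 0 = Polynomial.aeval (MvPolynomial.X 0) f := rfl

theorem X_sub_X_mul_dividedDifference_succ {R : Type*} [CommRing R] [IsDomain R] (f : R[X])
    (k : ℕ) :
    (MvPolynomial.X (Fin.last k).castSucc - MvPolynomial.X (Fin.last (k + 1))) *
        dividedDifference f (k + 1) =
      MvPolynomial.rename Fin.castSucc (dividedDifference f k) -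
        MvPolynomial.rename (Fin.last k).castSucc.succAbove (dividedDifference f k) :=
  (X_sub_X_dvd_rename_sub_rename (dividedDifference f k)).choose_spec.symm

theorem eq_dividedDifference_succ {R : Type*} [CommRing R] [IsDomain R] (f : R[X])
    (k : ℕ) (q : MvPolynomial (Fin (k + 2)) R)
    (hq : (MvPolynomial.X (Fin.last k).castSucc - MvPolynomial.X (Fin.last (k + 1))) * q =
      MvPolynomial.rename Fin.castSucc (dividedDifference f k) -
        MvPolynomial.rename (Fin.last k).castSucc.succAbove (dividedDifference f k)) :
    q = dividedDifference f (k + 1) := by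
  refine mul_left_cancel₀ (sub_ne_zero.2 fun h => ?_)
    (hq.trans (X_sub_X_mul_dividedDifference_succ f k).symm)
  exact (Fin.castSucc_lt_last (Fin.last k)).ne (MvPolynomial.X_injective h)

/-- `Int(M_n(D))`: the polynomials `f ∈ K[X]` with `f(M) ∈ M_n(D)` for all `M ∈ M_n(D)`, where
`M_n(D)` is seen inside `M_n(K)`. -/
def intValuedOnMatrices (D K : Type*) [CommRing D] [Field K] [Algebra D K] (n : ℕ) :
    Set K[X] :=
  {f | ∀ M : Matrix (Fin n) (Fin n) D, ∃ N : Matrix (Fin n) (Fin n) D,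
    Polynomial.aeval (M.map (algebraMap D K)) f = N.map (algebraMap D K)}

end

/-! Everything passes through the remainders of `f` modulo monic `p ∈ D[X]` of degree `n`: `f` is
integer-valued on `M_n(D)` iff all of them lie in `D[X]`, by companion matrices and Cayley-Hamilton
(`mem_intValuedOnMatrices_iff_modByMonic`). Over `L`, `p` splits, and the Newton coefficients of the
remainder at the roots are the divided differences of `f`; as `D` is integrally closed, the
remainder lies in `D[X]` iff these are integral (`modByMonic_mem_lifts_iff_dividedDifference`). For
irreducible `p`, write `f = g / d`. The condition becomes `d ∣ g %ₘ p`, which depends only on `p`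
modulo `d`, and `p` is congruent modulo `d` to an irreducible polynomial
(`exists_irreducible_C_dvd_sub`). -/

open Polynomial

namespace Polynomial

/-! ### Division by monic polynomials; irreducible polynomials in residue classes. -/

section DivByMonic

variable {A : Type*} [CommRing A]

theorem X_sub_C_mul_divByMonic_add_C_eval (g : A[X]) (a : A) :
    (X - C a) * (g /ₘ (X - C a)) + C (g.eval a) = g := by
  rw [← modByMonic_X_sub_C_eq_C_eval, add_comm]
  exact modByMonic_add_div g (X - C a)

theorem sub_mul_eval_divByMonic (g : A[X]) (a b : A) :
    (a - b) * (g /ₘ (X - C a)).eval b = g.eval a - g.eval b := by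
  have h := congrArg (eval b) (X_sub_C_mul_divByMonic_add_C_eval g a)
  simp only [eval_add, eval_mul, eval_sub, eval_X, eval_C] at h
  linear_combination -h

/-- One step of Newton interpolation: a new node `a` adds one term to the remainder. -/
theorem divByMonic_modByMonic_mul_X_sub_C [Nontrivial A] {p : A[X]} (hp : p.Monic)
    (g : A[X]) (a : A) :
    g /ₘ (p * (X - C a)) = g /ₘ p /ₘ (X - C a) ∧
      g %ₘ (p * (X - C a)) = g %ₘ p + p * C ((g /ₘ p).eval a) := by
  have hm : (p * (X - C a)).Monic := hp.mul (monic_X_sub_C a)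
  refine div_modByMonic_unique _ _ hm ⟨?_, ?_⟩
  · have h1 := modByMonic_add_div g p
    have h2 := X_sub_C_mul_divByMonic_add_C_eval (g /ₘ p) a
    linear_combination h1 + p * h2
  · have hd : degree (p * (X - C a)) = degree p + 1 := by
      rw [(monic_X_sub_C a).degree_mul, degree_X_sub_C]
    have hlt : degree p < degree (p * (X - C a)) := by
      rw [hd, degree_eq_natDegree hp.ne_zero]
      exact_mod_cast Nat.lt_succ_self _
    refine (degree_add_le _ _).trans_lt (max_lt ((degree_modByMonic_lt g hp).trans hlt) ?_)
    refine lt_of_le_of_lt ?_ hlt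
    rw [mul_comm, ← smul_eq_C_mul]
    exact degree_smul_le _ _

/-- The coefficients of `u` are divisible by `d` as soon as `u` vanishes modulo `d`. -/
theorem C_dvd_iff_map_mk_eq_zero (d : A) (u : A[X]) :
    C d ∣ u ↔ u.map (Ideal.Quotient.mk (Ideal.span {d})) = 0 := by
  rw [C_dvd_iff_dvd_coeff, Polynomial.ext_iff]
  simp [Ideal.Quotient.eq_zero_iff_dvd]

/-- Remainders by monic polynomials commute with reduction modulo `d`. -/
theorem C_dvd_modByMonic_of_C_dvd_sub {d : A} {p q g : A[X]} (hp : p.Monic) (hq : q.Monic)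
    (hpq : C d ∣ p - q) (h : C d ∣ g %ₘ q) : C d ∣ g %ₘ p := by
  rw [C_dvd_iff_map_mk_eq_zero] at *
  rw [map_modByMonic _ hp]
  rw [map_modByMonic _ hq] at h
  rw [Polynomial.map_sub, sub_eq_zero] at hpq
  rwa [hpq]

theorem exists_monic_irreducible_natDegree_eq (k : Type*) [Field k] [Finite k] {n : ℕ}
    (hn : 0 < n) : ∃ q : k[X], q.Monic ∧ q.natDegree = n ∧ Irreducible q := by
  have : NeZero n := ⟨hn.ne'⟩
  obtain ⟨p, hp⟩ := CharP.exists k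
  have : Fact p.Prime := ⟨CharP.char_is_prime k p⟩
  obtain ⟨x, hx⟩ := Field.exists_primitive_element k (FiniteField.Extension k p n)
  have hint : IsIntegral k x := Algebra.IsIntegral.isIntegral x
  refine ⟨minpoly k x, minpoly.monic hint, ?_, minpoly.irreducible hint⟩
  rw [(Field.primitive_element_iff_minpoly_natDegree_eq k x).1 hx,
    FiniteField.finrank_extension]

/-- A monic polynomial is congruent modulo `d` to an irreducible one of the same degree, if `d`
is not in some maximal ideal of finite index. -/
theorem exists_irreducible_C_dvd_sub [IsDomain A] {d : A} {m : Ideal A} [hm : m.IsMaximal]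
    [Finite (A ⧸ m)] (hd : d ∉ m) {p : A[X]} (hp : p.Monic) (h0 : 0 < p.natDegree) :
    ∃ q : A[X], q.Monic ∧ q.natDegree = p.natDegree ∧ Irreducible q ∧ C d ∣ p - q := by
  let := Ideal.Quotient.field m
  obtain ⟨r, hr, hrn, hri⟩ := exists_monic_irreducible_natDegree_eq (A ⧸ m) h0
  obtain ⟨s, hs, hsn, hsm⟩ := lifts_and_natDegree_eq_and_monic
    (mem_lifts_of_surjective Ideal.Quotient.mk_surjective r) hr
  obtain ⟨y, z, hz, hyz⟩ := hm.exists_inv hd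
  have hy : Ideal.Quotient.mk m (y * d) = 1 := by
    rw [← map_one (Ideal.Quotient.mk m), ← hyz, map_add, Ideal.Quotient.eq_zero_iff_mem.2 hz,
      add_zero]
  have hdeg : degree (C (y * d) * (s - p)) < degree p := by
    rw [← smul_eq_C_mul]
    refine (degree_smul_le _ _).trans_lt ?_
    have hsp : degree s = degree p := by
      rw [degree_eq_natDegree hsm.ne_zero, degree_eq_natDegree hp.ne_zero, hsn, hrn]
    exact (degree_sub_lt_left hsp hsm.ne_zero (by rw [hsm.leadingCoeff, hp.leadingCoeff])).trans_eq hsp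
  -- Since `y * d` is `0` modulo `d` and `1` modulo `m`, this polynomial is `p` modulo `d` and the
  -- irreducible `r` modulo `m`.
  have hq : (p + C (y * d) * (s - p)).Monic := hp.add_of_left hdeg
  refine ⟨p + C (y * d) * (s - p), hq,
    natDegree_eq_of_degree_eq (degree_add_eq_left_of_degree_lt hdeg), ?_, ?_⟩
  · refine hq.irreducible_of_irreducible_map (Ideal.Quotient.mk m) _ ?_
    rw [Polynomial.map_add, Polynomial.map_mul, map_C, hy, Polynomial.map_sub, hs]
    simpa using hri
  · exact ⟨-(C y * (s - p)), by rw [C_mul]; ring⟩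

end DivByMonic

end Polynomial

/-! ### Divided differences as values of quotients. -/

section DividedDifference

theorem map_eval_divByMonic_prod {R A B : Type*} [CommRing R] [CommRing A] [CommRing B] [Algebra R A]
    [Algebra R B] (φ : A →ₐ[R] B) (f : R[X]) {k : ℕ} (a : Fin k → A) (b : A) :
    φ ((f.map (algebraMap R A) /ₘ ∏ i, (X - C (a i))).eval b) =
      (f.map (algebraMap R B) /ₘ ∏ i, (X - C (φ (a i)))).eval (φ b) := by
  have h := (eval₂_at_apply (p := f.map (algebraMap R A) /ₘ ∏ i, (X - C (a i)))
    (φ : A →+* B) b).symm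
  rw [← eval_map, map_divByMonic _ (monic_prod_of_monic _ _ fun i _ => monic_X_sub_C _),
    Polynomial.map_map, Polynomial.map_prod] at h
  simpa using h

variable {R : Type*} [CommRing R] [IsDomain R]

/-- Dividing by one more `X - a` and evaluating at `b` gives the difference quotient of the values
at `a` and `b`. Unlike the recursion, this form specializes to repeated nodes. -/
theorem dividedDifference_eq_eval_divByMonic (f : R[X]) (k : ℕ) :
    dividedDifference f k =
      (f.map (algebraMap R (MvPolynomial (Fin (k + 1)) R)) /ₘ
        ∏ i : Fin k, (X - C (MvPolynomial.X i.castSucc))).eval (MvPolynomial.X (Fin.last k)) := by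
  induction k with
  | zero =>
    rw [dividedDifference_zero, ← eval_map_algebraMap]
    simp
  | succ k ih =>
    symm
    apply eq_dividedDifference_succ
    rw [ih, map_eval_divByMonic_prod, map_eval_divByMonic_prod]
    simp only [MvPolynomial.rename_X, Fin.succAbove_castSucc_self, Fin.succ_last]
    have h1 (i : Fin k) : (Fin.last k).castSucc.succAbove i.castSucc = i.castSucc.castSucc :=
      Fin.succAbove_of_castSucc_lt _ _ (by simp [Fin.lt_def])
    simp only [h1]
    rw [← sub_mul_eval_divByMonic, Fin.prod_univ_castSucc,
      (divByMonic_modByMonic_mul_X_sub_C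
        (monic_prod_of_monic _ _ fun i _ => monic_X_sub_C _) _ _).1]

theorem aeval_dividedDifference {A : Type*} [CommRing A] [Algebra R A] (f : R[X]) {k : ℕ}
    (α : Fin (k + 1) → A) :
    MvPolynomial.aeval α (dividedDifference f k) =
      (f.map (algebraMap R A) /ₘ ∏ i : Fin k, (X - C (α i.castSucc))).eval (α (Fin.last k)) := by
  rw [dividedDifference_eq_eval_divByMonic, map_eval_divByMonic_prod]
  simp

end DividedDifference

/-! ### Newton interpolation over a subring. -/

section Subring

variable {L : Type*} [CommRing L] (S : Subring L)

theorem prod_X_sub_C_mem_lifts {k : ℕ} {a : Fin k → L} (ha : ∀ i, a i ∈ S) :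
    ∏ i, (X - C (a i)) ∈ lifts S.subtype := by
  refine prod_mem fun i _ => ?_
  exact ⟨X - C ⟨a i, ha i⟩, by simp⟩

theorem eval_divByMonic_prod_mem {k : ℕ} {a : Fin k → L} (ha : ∀ i, a i ∈ S) {b : L}
    (hb : b ∈ S) {r : L[X]} (hr : r ∈ lifts S.subtype) :
    (r /ₘ ∏ i, (X - C (a i))).eval b ∈ S := by
  obtain ⟨r, rfl⟩ := hr
  have h : (r /ₘ ∏ i, (X - C (⟨a i, ha i⟩ : S))).map S.subtype =
      r.map S.subtype /ₘ ∏ i, (X - C (a i)) := by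
    rw [map_divByMonic _ (monic_prod_of_monic _ _ fun i _ => monic_X_sub_C _), Polynomial.map_prod]
    simp
  rw [coe_mapRingHom, ← h, eval_map, show b = S.subtype ⟨b, hb⟩ from rfl, eval₂_at_apply]
  exact Subtype.coe_prop _

/-- Newton interpolation: the remainder of `g` modulo `∏ (X - a i)` has coefficients in a subring
containing the `a i` and the divided differences of `g`. -/
theorem modByMonic_prod_mem_lifts [Nontrivial L] (g : L[X]) {n : ℕ} (a : Fin n → L)
    (ha : ∀ i, a i ∈ S)
    (h : ∀ k (hk : k < n), (g /ₘ ∏ i : Fin k, (X - C (a (i.castLE hk.le)))).eval (a ⟨k, hk⟩) ∈ S) :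
    g %ₘ ∏ i, (X - C (a i)) ∈ lifts S.subtype := by
  induction n with
  | zero => simp [modByMonic_one, zero_mem]
  | succ n ih =>
    rw [Fin.prod_univ_castSucc, (divByMonic_modByMonic_mul_X_sub_C
      (monic_prod_of_monic _ _ fun i _ => monic_X_sub_C _) _ _).2]
    refine add_mem (ih _ (fun i => ha _) fun k hk => h k (hk.trans n.lt_succ_self)) ?_
    refine mul_mem (prod_X_sub_C_mem_lifts S fun i => ha _) ?_
    exact C'_mem_lifts ⟨⟨_, h n n.lt_succ_self⟩, rfl⟩

end Subring

/-! ### Integer-valued polynomials and remainders. -/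

section IntValued

variable {D K : Type*} [CommRing D] [Field K] [Algebra D K]

theorem aeval_matrix_map {n : ℕ} (M : Matrix (Fin n) (Fin n) D) (r : D[X]) :
    aeval (M.map (algebraMap D K)) (r.map (algebraMap D K)) =
      (aeval M r).map (algebraMap D K) := by
  rw [aeval_map_algebraMap]
  exact aeval_algHom_apply ((Algebra.ofId D K).mapMatrix (m := Fin n)) M r

theorem exists_C_mul_map_eq [IsDomain D] [IsFractionRing D K] (f : K[X]) :
    ∃ (d : D) (g : D[X]), d ≠ 0 ∧ g.map (algebraMap D K) = C (algebraMap D K d) * f := by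
  obtain ⟨b, hb, h⟩ := IsLocalization.integerNormalization_spec (nonZeroDivisors D) f
  refine ⟨b, _, nonZeroDivisors.ne_zero hb, h.trans ?_⟩
  rw [← smul_eq_C_mul, algebraMap_smul]

theorem modByMonic_map_mem_lifts_iff [IsDomain D] [IsFractionRing D K] {f : K[X]} {d : D}
    {g : D[X]} (hd : d ≠ 0) (h : g.map (algebraMap D K) = C (algebraMap D K d) * f)
    {p : D[X]} (hp : p.Monic) :
    f %ₘ p.map (algebraMap D K) ∈ lifts (algebraMap D K) ↔ C d ∣ g %ₘ p := by
  have hinj := IsFractionRing.injective D K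
  have hd' : C (algebraMap D K d) ≠ 0 := by simpa using hd
  have key : (g %ₘ p).map (algebraMap D K) =
      C (algebraMap D K d) * (f %ₘ p.map (algebraMap D K)) := by
    rw [map_modByMonic _ hp, h, ← smul_eq_C_mul, ← smul_eq_C_mul, smul_modByMonic]
  constructor
  · rintro ⟨u, hu⟩
    refine ⟨u, map_injective _ hinj ?_⟩
    rw [key, ← hu, Polynomial.map_mul, map_C, coe_mapRingHom]
  · rintro ⟨u, hu⟩
    refine ⟨u, mul_left_cancel₀ hd' ?_⟩
    rw [← key, hu, Polynomial.map_mul, map_C, coe_mapRingHom]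

theorem mem_intValuedOnMatrices_iff_modByMonic [IsDomain D] [IsFractionRing D K] (f : K[X])
    (n : ℕ) :
    f ∈ intValuedOnMatrices D K n ↔ ∀ p : D[X], p.Monic → p.natDegree = n →
      f %ₘ p.map (algebraMap D K) ∈ lifts (algebraMap D K) := by
  constructor
  · rintro hf p hp rfl
    obtain ⟨d, g, hd, hg⟩ := exists_C_mul_map_eq (D := D) f
    rw [modByMonic_map_mem_lifts_iff hd hg hp]
    -- The test matrix is the companion matrix of `p`: multiplication by the root on `D[X]/(p)`.
    let b : Module.Basis (Fin p.natDegree) D (AdjoinRoot p) := (AdjoinRoot.powerBasis' hp).basis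
    obtain ⟨N, hN⟩ := hf (Algebra.leftMulMatrix b (AdjoinRoot.root p))
    have h1 : Algebra.leftMulMatrix b (AdjoinRoot.mk p g) = d • N := by
      apply Matrix.map_injective (IsFractionRing.injective D K)
      beta_reduce
      rw [← AdjoinRoot.aeval_eq, ← aeval_algHom_apply, ← aeval_matrix_map, hg, map_mul, hN,
        aeval_C, ← Algebra.smul_def]
      ext i j
      simp
    -- Applying both matrices to `1` recovers the class of `g`, which is thus `d` times a class.
    obtain ⟨h, hh⟩ := AdjoinRoot.mk_surjective (Matrix.toLin b b N 1)
    have h2 : AdjoinRoot.mk p g = AdjoinRoot.mk p (C d * h) := by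
      have := congrArg (fun M => Matrix.toLin b b M 1) h1
      simp only [Matrix.toLin_toMatrix, map_smul,
        LinearMap.smul_apply, Algebra.leftMulMatrix_apply] at this
      rw [map_mul, hh, AdjoinRoot.mk_C, ← AdjoinRoot.algebraMap_eq, ← Algebra.smul_def, ← this]
      simp
    rw [AdjoinRoot.mk_eq_mk] at h2
    have h3 : g %ₘ p = (C d * h) %ₘ p := by
      rw [← sub_eq_zero, ← sub_modByMonic]
      exact (modByMonic_eq_zero_iff_dvd hp).2 h2
    rw [h3, ← smul_eq_C_mul, smul_modByMonic, smul_eq_C_mul]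
    exact dvd_mul_right _ _
  · intro h M
    obtain ⟨r, hr⟩ := h M.charpoly M.charpoly_monic (by simp [M.charpoly_natDegree_eq_dim])
    refine ⟨aeval M r, ?_⟩
    rw [← aeval_matrix_map, ← coe_mapRingHom, hr]
    conv_lhs => rw [← modByMonic_add_div f (M.charpoly.map (algebraMap D K))]
    rw [map_add, map_mul, aeval_matrix_map, Matrix.aeval_self_charpoly]
    simp

theorem Multiset.exists_map_univ_fin_eq {A : Type*} (s : Multiset A) :
    ∃ a : Fin s.card → A, Multiset.map a Finset.univ.val = s := by
  induction s using Quotient.inductionOn with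
  | h l => exact ⟨l.get, (Fin.univ_val_map l.get).trans (congrArg _ (List.ofFn_get l))⟩

theorem modByMonic_mem_lifts_iff_dividedDifference {L : Type*} [IsDomain D]
    [IsIntegrallyClosed D] [IsFractionRing D K] [Field L] [Algebra K L] [IsAlgClosed L]
    [Algebra D L] [IsScalarTower D K L] (f : K[X]) {p : D[X]} (hp : p.Monic) :
    f %ₘ p.map (algebraMap D K) ∈ lifts (algebraMap D K) ↔
      ∀ k < p.natDegree, ∀ α : Fin (k + 1) → L, Multiset.map α Finset.univ.val ≤ p.aroots L →
        IsIntegral D (MvPolynomial.aeval α (dividedDifference f k)) := by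
  have hpL : (p.map (algebraMap D L)).Monic := hp.map _
  have hroot : ∀ x ∈ p.aroots L, x ∈ (integralClosure D L).toSubring := fun x hx =>
    ⟨p, hp, by simpa [aeval_def] using (mem_aroots'.1 hx).2⟩
  have hmap : (f %ₘ p.map (algebraMap D K)).map (algebraMap K L) =
      f.map (algebraMap K L) %ₘ p.map (algebraMap D L) := by
    rw [map_modByMonic _ (hp.map _), Polynomial.map_map, ← IsScalarTower.algebraMap_eq]
  constructor
  · rintro ⟨r, hr⟩ k - α hα
    have hαS : ∀ i, α i ∈ (integralClosure D L).toSubring := fun i =>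
      hroot _ (Multiset.mem_of_le hα (Multiset.mem_map_of_mem _ (Finset.mem_univ i)))
    obtain ⟨s, hs⟩ := (Multiset.prod_X_sub_C_dvd_iff_le_roots hpL.ne_zero _).2 hα
    rw [Multiset.map_map] at hs
    change _ = (∏ i, (X - C (α i))) * s at hs
    rw [Fin.prod_univ_castSucc] at hs
    rw [aeval_dividedDifference]
    set u := ∏ i : Fin k, (X - C (α i.castSucc)) with hu
    have humon : u.Monic := monic_prod_of_monic _ _ fun i _ => monic_X_sub_C _
    -- `f` differs from its remainder `r` by a multiple of `p`, hence of `u * (X - C (α (Fin.last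
    -- k)))`; the extra term vanishes at the last node.
    have hdiv : f.map (algebraMap K L) /ₘ u =
        r.map (algebraMap D L) /ₘ u + (X - C (α (Fin.last k))) *
          (s * (f.map (algebraMap K L) /ₘ p.map (algebraMap D L))) := by
      refine (div_modByMonic_unique _ (r.map (algebraMap D L) %ₘ u) humon
        ⟨?_, degree_modByMonic_lt _ humon⟩).1
      have h1 := modByMonic_add_div (r.map (algebraMap D L)) u
      have h2 := modByMonic_add_div (f.map (algebraMap K L)) (p.map (algebraMap D L))
      rw [← hmap, ← hr, coe_mapRingHom, Polynomial.map_map, ← IsScalarTower.algebraMap_eq] at h2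
      linear_combination h1 + h2 - (f.map (algebraMap K L) /ₘ p.map (algebraMap D L)) * hs
    rw [hdiv, eval_add, eval_mul]
    simp only [eval_sub, eval_X, eval_C, sub_self, zero_mul, add_zero]
    refine eval_divByMonic_prod_mem (integralClosure D L).toSubring (fun i => hαS _) (hαS _) ?_
    rw [lifts_iff_coeff_lifts]
    intro i
    rw [coeff_map]
    exact ⟨⟨_, isIntegral_algebraMap⟩, rfl⟩
  · intro h
    have hsplit := (IsAlgClosed.splits (p.map (algebraMap D L))).eq_prod_roots_of_monic hpL
    have hcard : (p.aroots L).card = p.natDegree := by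
      rw [← (IsAlgClosed.splits (p.map (algebraMap D L))).natDegree_eq_card_roots,
        hp.natDegree_map]
    obtain ⟨a, ha⟩ : ∃ a : Fin p.natDegree → L, Multiset.map a Finset.univ.val = p.aroots L := by
      rw [← hcard]
      exact Multiset.exists_map_univ_fin_eq _
    have haS : ∀ i, a i ∈ (integralClosure D L).toSubring := fun i =>
      hroot _ (ha ▸ Multiset.mem_map_of_mem _ (Finset.mem_univ i))
    have hprod : p.map (algebraMap D L) = ∏ i, (X - C (a i)) := by
      rw [hsplit]
      change ((p.aroots L).map _).prod = _
      rw [← ha, Multiset.map_map]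
      rfl
    have hmem : f.map (algebraMap K L) %ₘ p.map (algebraMap D L) ∈
        lifts (integralClosure D L).toSubring.subtype := by
      rw [hprod]
      refine modByMonic_prod_mem_lifts _ _ a haS fun k hk => ?_
      -- The first `k + 1` roots: `hk : k < p.natDegree` unfolds to `k + 1 ≤ p.natDegree`.
      have := h k hk (fun i => a (i.castLE hk)) ?_
      · rw [aeval_dividedDifference] at this
        exact this
      · rw [← ha]
        change Multiset.map (a ∘ Fin.castLE hk) _ ≤ _
        rw [← Multiset.map_map]
        refine Multiset.map_le_map ?_
        exact Finset.val_le_iff.2 (Finset.subset_univ (Finset.univ.map (Fin.castLEEmb hk)))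
    rw [← hmap, lifts_iff_coeff_lifts] at hmem
    rw [lifts_iff_coeff_lifts]
    intro i
    obtain ⟨⟨y, hy⟩, hyi⟩ := hmem i
    rw [coeff_map] at hyi
    change y = _ at hyi
    subst hyi
    exact IsIntegrallyClosed.isIntegral_iff.1
      ((isIntegral_algebraMap_iff (algebraMap K L).injective).1 hy)

end IntValued

theorem theorem4p1 {D K L : Type*} [CommRing D] [IsDomain D] [IsIntegrallyClosed D]
    [Field K] [Algebra D K] [IsFractionRing D K]
    [Field L] [Algebra K L] [IsAlgClosure K L] [Algebra D L] [IsScalarTower D K L]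
    (f : K[X]) (n : ℕ) (hn : 0 < n) :
    (f ∈ intValuedOnMatrices D K n ↔
      ∀ k < n, ∀ p : D[X], p.Monic → p.natDegree = n →
        ∀ α : Fin (k + 1) → L, Multiset.map α Finset.univ.val ≤ p.aroots L →
          IsIntegral D (MvPolynomial.aeval α (dividedDifference f k))) ∧
    (sInf {m : Ideal D | m.IsMaximal ∧ Finite (D ⧸ m)} = ⊥ →
      (f ∈ intValuedOnMatrices D K n ↔
        ∀ k < n, ∀ p : D[X], p.Monic → p.natDegree = n → Irreducible p →
          ∀ α : Fin (k + 1) → L, Multiset.map α Finset.univ.val ≤ p.aroots L →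
            IsIntegral D (MvPolynomial.aeval α (dividedDifference f k)))) := by

  have : IsAlgClosed L := IsAlgClosure.isAlgClosed K
  have key := fun (p : D[X]) (hp : p.Monic) =>
    modByMonic_mem_lifts_iff_dividedDifference (L := L) f hp
  have hall : f ∈ intValuedOnMatrices D K n ↔
      ∀ k < n, ∀ p : D[X], p.Monic → p.natDegree = n →
        ∀ α : Fin (k + 1) → L, Multiset.map α Finset.univ.val ≤ p.aroots L →
          IsIntegral D (MvPolynomial.aeval α (dividedDifference f k)) := by
    rw [mem_intValuedOnMatrices_iff_modByMonic]
    constructor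
    · intro h k hk p hp hpn
      exact (key p hp).1 (h p hp hpn) k (hpn ▸ hk)
    · intro h p hp hpn
      exact (key p hp).2 fun k hk => h k (hpn ▸ hk) p hp hpn
  refine ⟨hall, fun hinf => ⟨fun hf k hk p hp hpn _ => hall.1 hf k hk p hp hpn, fun h => ?_⟩⟩
  rw [mem_intValuedOnMatrices_iff_modByMonic]
  rintro p hp rfl
  obtain ⟨d, g, hd, hg⟩ := exists_C_mul_map_eq (D := D) f
  -- The denominator `d` is nonzero, so some maximal ideal of finite index avoids it.
  have hdm : d ∉ sInf {m : Ideal D | m.IsMaximal ∧ Finite (D ⧸ m)} := by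
    rwa [hinf, Ideal.mem_bot]
  rw [Submodule.mem_sInf] at hdm
  push Not at hdm
  obtain ⟨m, ⟨hmax, hfin⟩, hm⟩ := hdm
  obtain ⟨q, hq, hqn, hqi, hpq⟩ := exists_irreducible_C_dvd_sub hm hp hn
  rw [modByMonic_map_mem_lifts_iff hd hg hp]
  refine C_dvd_modByMonic_of_C_dvd_sub hp hq hpq ?_
  rw [← modByMonic_map_mem_lifts_iff hd hg hq]
  exact (key q hq).2 fun k hk => h k (hqn ▸ hk) q hq hqn hqi
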